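/- Let $U=(u_{ij})_{i,j\in\{0,1\}}$ be a real $2\times 2$ matrix, regarded as a zero-sum game in which the first player, with mixed strategy $(x,1-x)$, minimizes and the second player, with mixed strategy $(y,1-y)$, maximizes the payoff $\binom{x}{1-x}^{\top}U\binom{y}{1-y}$, where $x,y\in[0,1]$. Assume that $U$ has a unique mixed-strategy Nash equilibrium $(p,q)$ and that $p,q\in(0,1)$; equivalently, $v=u_{0,0}-u_{0,1}-u_{1,0}+u_{1,1}\neq 0$, $q=-\frac{u_{0,1}-u_{1,1}}{v}\in(0,1)$ and $p=-\frac{u_{1,0}-u_{1,1}}{v}\in(0,1)$. Let $f:\mathbb{R}^n\to[0,1]$ and $g:\mathbb{R}^m\to[0,1]$ be $C^2$ functions and let $$r(\theta,\phi)=\binom{f(\theta)}{1-f(\theta)}^{\top}U\binom{g(\phi)}{1-g(\phi)},\qquad \theta\in\mathbb{R}^n,\ \phi\in\mathbb{R}^m .$$ Let $f_{\theta_0}$ be the set of values $f(x(t))$, $t\in\mathbb{R}$, along the gradient ascent trajectory $\dot x=\nabla f(x)$, $x(0)=\theta_0$, and let $g_{\phi_0}$ be defined in the same way from $g$ and $\phi_0$.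 Let $(\theta_0,\phi_0)$ be safe, that is, $\nabla f(\theta_0)\neq 0$, $\nabla g(\phi_0)\neq 0$, $p\in f_{\theta_0}$ and $q\in g_{\phi_0}$. Then the continuous gradient-descent-ascent system $$\dot\theta=-\nabla_\theta r(\theta,\phi)=-v\,\nabla f(\theta)\,(g(\phi)-q),\qquad \dot\phi=\nabla_\phi r(\theta,\phi)=v\,\nabla g(\phi)\,(f(\theta)-p)$$ has exactly one solution $(\theta(t),\phi(t))$, $t\in\mathbb{R}$, with $(\theta(0),\phi(0))=(\theta_0,\phi_0)$, and this orbit is periodic: there is $T>0$ with $(\theta(t+T),\phi(t+T))=(\theta(t),\phi(t))$ for all $t\in\mathbb{R}$. (A constant orbit counts as periodic.) -/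

import Mathlib

open Matrix

noncomputable section

namespace HiddenGame

/-- Payoff of the `2 × 2` zero-sum game `U` at the mixed strategies `(x, 1 - x)`, `(y, 1 - y)`. -/
def payoff (U : Matrix (Fin 2) (Fin 2) ℝ) (x y : ℝ) : ℝ :=
  ![x, 1 - x] ⬝ᵥ (U *ᵥ ![y, 1 - y])

/-- `(p, q)` is a Nash equilibrium in mixed strategies of the zero-sum game `U`: the first player
minimizes the payoff and the second one maximizes it. -/
def IsNash (U : Matrix (Fin 2) (Fin 2) ℝ) (p q : ℝ) : Prop :=
  p ∈ Set.Icc (0 : ℝ) 1 ∧ q ∈ Set.Icc (0 : ℝ) 1 ∧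
    (∀ x ∈ Set.Icc (0 : ℝ) 1, payoff U p q ≤ payoff U x q) ∧
    (∀ y ∈ Set.Icc (0 : ℝ) 1, payoff U p y ≤ payoff U p q)

/-- `(p, q)` is the unique Nash equilibrium of `U`, and both strategies are fully mixed. -/
def IsUniqueMixedNash (U : Matrix (Fin 2) (Fin 2) ℝ) (p q : ℝ) : Prop :=
  p ∈ Set.Ioo (0 : ℝ) 1 ∧ q ∈ Set.Ioo (0 : ℝ) 1 ∧ IsNash U p q ∧
    ∀ p' q', IsNash U p' q' → p' = p ∧ q' = q

/-- The number `v = u₀₀ - u₀₁ - u₁₀ + u₁₁` attached to the game `U`. -/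
def gameCoeff (U : Matrix (Fin 2) (Fin 2) ℝ) : ℝ :=
  U 0 0 - U 0 1 - U 1 0 + U 1 1

/-- The payoff `r(θ, φ) = F(θ)ᵀ U G(φ)` of the hidden game, where `F = (f, 1 - f)` and
`G = (g, 1 - g)`. -/
def hiddenPayoff {n m : ℕ} (U : Matrix (Fin 2) (Fin 2) ℝ)
    (f : EuclideanSpace ℝ (Fin n) → ℝ) (g : EuclideanSpace ℝ (Fin m) → ℝ)
    (θ : EuclideanSpace ℝ (Fin n)) (φ : EuclideanSpace ℝ (Fin m)) : ℝ :=
  payoff U (f θ) (g φ)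

/-- `z = (θ, φ)` is the continuous gradient-descent-ascent orbit of the hidden game started at
`(θ₀, φ₀)`: `θ' = -∇_θ r(θ, φ)`, `φ' = ∇_φ r(θ, φ)` for all times `t ∈ ℝ`. -/
def IsGDAOrbit {n m : ℕ} (U : Matrix (Fin 2) (Fin 2) ℝ)
    (f : EuclideanSpace ℝ (Fin n) → ℝ) (g : EuclideanSpace ℝ (Fin m) → ℝ)
    (θ₀ : EuclideanSpace ℝ (Fin n)) (φ₀ : EuclideanSpace ℝ (Fin m))
    (z : ℝ → EuclideanSpace ℝ (Fin n) × EuclideanSpace ℝ (Fin m)) : Prop :=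
  z 0 = (θ₀, φ₀) ∧ ∀ t : ℝ,
    HasDerivAt (fun s => (z s).1)
      (-gradient (fun θ => hiddenPayoff U f g θ (z t).2) (z t).1) t ∧
    HasDerivAt (fun s => (z s).2)
      (gradient (fun φ => hiddenPayoff U f g (z t).1 φ) (z t).2) t

/-- `x` is the trajectory of gradient ascent `x' = ∇k(x)`, `t ∈ ℝ`, with `x(0) = x₀`. -/
def IsGradientAscent {d : ℕ} (k : EuclideanSpace ℝ (Fin d) → ℝ)
    (x₀ : EuclideanSpace ℝ (Fin d)) (x : ℝ → EuclideanSpace ℝ (Fin d)) : Prop :=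
  x 0 = x₀ ∧ ∀ t : ℝ, HasDerivAt x (gradient k (x t)) t

/-- The set `k_{x₀}` of the values that `k` attains along gradient ascent through `x₀`. -/
def attainable {d : ℕ} (k : EuclideanSpace ℝ (Fin d) → ℝ)
    (x₀ : EuclideanSpace ℝ (Fin d)) : Set ℝ :=
  {y | ∃ x : ℝ → EuclideanSpace ℝ (Fin d), IsGradientAscent k x₀ x ∧ ∃ t : ℝ, k (x t) = y}

/-- Safe initial conditions. -/
structure IsSafe {n m : ℕ}
    (f : EuclideanSpace ℝ (Fin n) → ℝ) (g : EuclideanSpace ℝ (Fin m) → ℝ) (p q : ℝ)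
    (θ₀ : EuclideanSpace ℝ (Fin n)) (φ₀ : EuclideanSpace ℝ (Fin m)) : Prop where
  grad_f_ne : gradient f θ₀ ≠ 0
  grad_g_ne : gradient g φ₀ ≠ 0
  p_mem : p ∈ attainable f θ₀
  q_mem : q ∈ attainable g φ₀

theorem payoff_eq (U : Matrix (Fin 2) (Fin 2) ℝ) (x y : ℝ) :
    payoff U x y = gameCoeff U * x * y + (U 0 1 - U 1 1) * x + (U 1 0 - U 1 1) * y + U 1 1 := by
  simp [payoff, gameCoeff, Matrix.mulVec, dotProduct, Fin.sum_univ_two]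
  ring

/-- The unique interior equilibrium in terms of the entries of the payoff matrix. -/
theorem isUniqueMixedNash_iff (U : Matrix (Fin 2) (Fin 2) ℝ) (p q : ℝ) :
    IsUniqueMixedNash U p q ↔
      gameCoeff U ≠ 0 ∧ p ∈ Set.Ioo (0 : ℝ) 1 ∧ q ∈ Set.Ioo (0 : ℝ) 1 ∧
        q = -(U 0 1 - U 1 1) / gameCoeff U ∧ p = -(U 1 0 - U 1 1) / gameCoeff U := by
  unfold IsUniqueMixedNash IsNash
  simp only [payoff_eq, Set.mem_Icc, Set.mem_Ioo]
  generalize gameCoeff U = v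
  generalize U 0 1 - U 1 1 = a
  generalize U 1 0 - U 1 1 = b
  constructor
  · rintro ⟨⟨hp0, hp1⟩, ⟨hq0, hq1⟩, ⟨-, -, h1, h2⟩, hu⟩
    have e1 : v * q + a = 0 := by
      have A := h1 0 (by norm_num)
      have B := h1 1 (by norm_num)
      have A' : p * (v * q + a) ≤ 0 := by linarith
      have B' : 0 ≤ (1 - p) * (v * q + a) := by linarith
      exact le_antisymm (by by_contra! h; nlinarith [mul_pos hp0 h])
        (nonneg_of_mul_nonneg_right B' (by linarith))
    have e2 : v * p + b = 0 := by
      have A := h2 0 (by norm_num)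
      have B := h2 1 (by norm_num)
      have A' : 0 ≤ q * (v * p + b) := by linarith
      have B' : (1 - q) * (v * p + b) ≤ 0 := by linarith
      exact le_antisymm (by by_contra! h; nlinarith [mul_pos (sub_pos.2 hq1) h])
        (nonneg_of_mul_nonneg_right A' hq0)
    have hv : v ≠ 0 := by
      rintro rfl
      have ha : a = 0 := by linarith
      have hb : b = 0 := by linarith
      subst ha hb
      have := hu 0 q ⟨by norm_num, ⟨hq0.le, hq1.le⟩, by simp, by simp⟩
      linarith [this.1]
    refine ⟨hv, ⟨hp0, hp1⟩, ⟨hq0, hq1⟩, ?_, ?_⟩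
    · rw [eq_div_iff hv]; linarith
    · rw [eq_div_iff hv]; linarith
  · rintro ⟨hv, ⟨hp0, hp1⟩, ⟨hq0, hq1⟩, hq, hp⟩
    rw [eq_div_iff hv] at hq hp
    obtain rfl : a = -(q * v) := by linarith
    obtain rfl : b = -(p * v) := by linarith
    refine ⟨⟨hp0, hp1⟩, ⟨hq0, hq1⟩, ⟨⟨hp0.le, hp1.le⟩, ⟨hq0.le, hq1.le⟩, ?_, ?_⟩, ?_⟩
    · intro x _; apply le_of_eq; ring
    · intro y _; apply le_of_eq; ring
    · rintro p' q' ⟨-, -, h1, h2⟩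
      have k1 : ∀ x, 0 ≤ x → x ≤ 1 → 0 ≤ (v * (q' - q)) * (x - p') := fun x h h' => by
        have := h1 x ⟨h, h'⟩; linarith
      have k2 : ∀ y, 0 ≤ y → y ≤ 1 → (v * (p' - p)) * (y - q') ≤ 0 := fun y h h' => by
        have := h2 y ⟨h, h'⟩; linarith
      have m1 := k1 p hp0.le hp1.le
      have m2 := k2 q hq0.le hq1.le
      have z : (v * (q' - q)) * (p - p') = 0 := by linarith
      have zero_of : ∀ c s t : ℝ, 0 < t → t < 1 → c * (t - s) = 0 →
          (∀ x, 0 ≤ x → x ≤ 1 → 0 ≤ c * (x - s)) → c = 0 := by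
        intro c s t ht0 ht1 hc h
        have A := h 0 le_rfl zero_le_one
        have B := h 1 zero_le_one le_rfl
        have A' : c * t ≤ 0 := by linarith
        have B' : 0 ≤ c * (1 - t) := by linarith
        exact le_antisymm (nonpos_of_mul_nonpos_left A' ht0)
          (nonneg_of_mul_nonneg_left B' (by linarith))
      have c1 := zero_of _ _ _ hp0 hp1 z k1
      have c2 := zero_of (-(v * (p' - p))) q' q hq0 hq1 (by linarith)
        (fun y h h' => by have := k2 y h h'; linarith)
      constructor
      · have := (mul_eq_zero.1 (neg_eq_zero.1 c2)).resolve_left hv; linarith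
      · have := (mul_eq_zero.1 c1).resolve_left hv; linarith

theorem gradient_affine_comp {d : ℕ} {k : EuclideanSpace ℝ (Fin d) → ℝ}
    (hk : Differentiable ℝ k) (a b : ℝ) (x : EuclideanSpace ℝ (Fin d)) :
    gradient (fun y => a * k y + b) x = a • gradient k x := by
  have h : HasFDerivAt (fun y => a * k y + b) (a • fderiv ℝ k x) x :=
    ((hk x).hasFDerivAt.const_mul a).add_const b
  simp [gradient, h.fderiv]

/-- The gradient-descent-ascent equations written out:
`θ' = -v (g(φ) - q) ∇f(θ)` and `φ' = v (f(θ) - p) ∇g(φ)`. -/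
theorem isGDAOrbit_iff {n m : ℕ} {U : Matrix (Fin 2) (Fin 2) ℝ} {p q : ℝ}
    {f : EuclideanSpace ℝ (Fin n) → ℝ} {g : EuclideanSpace ℝ (Fin m) → ℝ}
    (hf : Differentiable ℝ f) (hg : Differentiable ℝ g) (hN : IsUniqueMixedNash U p q)
    (θ₀ : EuclideanSpace ℝ (Fin n)) (φ₀ : EuclideanSpace ℝ (Fin m))
    (z : ℝ → EuclideanSpace ℝ (Fin n) × EuclideanSpace ℝ (Fin m)) :
    IsGDAOrbit U f g θ₀ φ₀ z ↔ z 0 = (θ₀, φ₀) ∧ ∀ t : ℝ,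
      HasDerivAt (fun s => (z s).1)
        (-(gameCoeff U * (g (z t).2 - q)) • gradient f (z t).1) t ∧
      HasDerivAt (fun s => (z s).2)
        ((gameCoeff U * (f (z t).1 - p)) • gradient g (z t).2) t := by
  obtain ⟨hv, -, -, hq, hp⟩ := (isUniqueMixedNash_iff U p q).1 hN
  rw [eq_div_iff hv] at hq hp
  have e1 : ∀ φ, (fun θ => hiddenPayoff U f g θ φ) =
      fun θ => gameCoeff U * (g φ - q) * f θ + ((U 1 0 - U 1 1) * g φ + U 1 1) := by
    intro φ; funext θ; rw [hiddenPayoff, payoff_eq]; linear_combination f θ * hq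
  have e2 : ∀ θ, (fun φ => hiddenPayoff U f g θ φ) =
      fun φ => gameCoeff U * (f θ - p) * g φ + ((U 0 1 - U 1 1) * f θ + U 1 1) := by
    intro θ; funext φ; rw [hiddenPayoff, payoff_eq]; linear_combination g φ * hp
  have d1 : ∀ θ φ, gradient (fun θ => hiddenPayoff U f g θ φ) θ =
      (gameCoeff U * (g φ - q)) • gradient f θ := by
    intro θ φ; rw [e1, gradient_affine_comp hf]
  have d2 : ∀ θ φ, gradient (fun φ => hiddenPayoff U f g θ φ) φ =
      (gameCoeff U * (f θ - p)) • gradient g φ := by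
    intro θ φ; rw [e2, gradient_affine_comp hg]
  simp only [IsGDAOrbit, d1, d2, neg_smul]

end HiddenGame

end

/-!
The orbit is found on the product of the two gradient ascent trajectories `x` and `y` through `θ₀`
and `φ₀`, which exist for all times because `p` and `q` are attained along them. Putting
`θ = x(α)` and `φ = y(β)` reduces gradient-descent-ascent, up to the constant factor `v` in time, to
the planar system
`α' = -w(β)`, `β' = u(α)`, where `u = f ∘ x - p` and `w = g ∘ y - q`.
As `∇f(θ₀)` and `∇g(φ₀)` do not vanish, `u` and `w` are strictly increasing, since
`(f ∘ x)' = ‖∇f(x)‖² > 0`; safety gives them zeros `a` and `b`; and they are bounded by `1`, so that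
the planar field is complete (`exists_integralCurve_of_bounded`).

If `A' = u` and `B' = w`, then `A` and `B` are strictly convex and coercive with minima at `a` and
`b`, and `A(α) + B(β)` is conserved. Hence the planar orbit is bounded, and a monotonicity argument
(`not_forall_gt_of_bounded`) shows that it meets the line `α = a` at arbitrarily late times. On this
line the conserved quantity leaves at most two values for `β`, so that among three visits two
coincide (`not_injective_of_strictMono`). An orbit of a `C¹` field that meets itself is periodic,
and uniqueness for the full system, whose field is `C¹` as `f` and `g` are `C²`, shows that the
orbit constructed in this way is the only one.
-/

/-! ### Global integral curves of a `C¹` vector field on a normed space -/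

section GlobalODE

open scoped Manifold ContDiff NNReal

variable {E : Type*} [NormedAddCommGroup E] [NormedSpace ℝ E]

theorem isMIntegralCurve_iff_hasDerivAt {X : E → E} {γ : ℝ → E} :
    IsMIntegralCurve (I := 𝓘(ℝ, E)) γ X ↔ ∀ t, HasDerivAt γ (X (γ t)) t := by
  refine forall_congr' fun t => ?_
  rw [hasDerivAt_iff_hasFDerivAt]
  exact hasMFDerivAt_iff_hasFDerivAt

theorem contMDiff_section_of_contDiff {X : E → E} (hX : ContDiff ℝ 1 X) :
    ContMDiff 𝓘(ℝ, E) 𝓘(ℝ, E).tangent 1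
      (fun x => (⟨x, X x⟩ : TangentBundle 𝓘(ℝ, E) E)) :=
  contMDiff_vectorSpace_iff_contDiff.2 hX

theorem integralCurve_eq_of_contDiff {X : E → E} (hX : ContDiff ℝ 1 X) {γ γ' : ℝ → E}
    (hγ : ∀ t, HasDerivAt γ (X (γ t)) t) (hγ' : ∀ t, HasDerivAt γ' (X (γ' t)) t) {t₀ : ℝ}
    (h : γ t₀ = γ' t₀) : γ = γ' :=
  isMIntegralCurve_Ioo_eq_of_contMDiff_boundaryless (contMDiff_section_of_contDiff hX)
    (isMIntegralCurve_iff_hasDerivAt.2 hγ) (isMIntegralCurve_iff_hasDerivAt.2 hγ') h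

/-- An orbit of an autonomous system that visits a point twice is periodic. -/
theorem exists_periodic_of_not_injective {X : E → E} (hX : ContDiff ℝ 1 X) {γ : ℝ → E}
    (hγ : ∀ t, HasDerivAt γ (X (γ t)) t) (h : ¬ Function.Injective γ) :
    ∃ T, 0 < T ∧ Function.Periodic γ T :=
  (((isMIntegralCurve_iff_hasDerivAt.2 hγ).periodic_xor_injective
    (contMDiff_section_of_contDiff hX)).or).resolve_right h

/-- A bounded `C¹` vector field is complete. An integral curve on `[-a, a]` stays in the ball of
radius `L * a`, so that the Picard–Lindelöf theorem applies on every such interval at once. -/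
theorem exists_integralCurve_of_bounded [FiniteDimensional ℝ E] {X : E → E}
    (hX : ContDiff ℝ 1 X) {L : ℝ≥0} (hL : ∀ x, ‖X x‖ ≤ L) (x₀ : E) :
    ∃ γ : ℝ → E, γ 0 = x₀ ∧ ∀ t, HasDerivAt γ (X (γ t)) t := by
  have := FiniteDimensional.proper_real E
  have := FiniteDimensional.complete ℝ E
  suffices h : ∃ γ : ℝ → E, γ 0 = x₀ ∧ IsMIntegralCurve (I := 𝓘(ℝ, E)) γ X by
    simpa only [isMIntegralCurve_iff_hasDerivAt] using h
  rw [exists_isMIntegralCurve_iff_exists_isMIntegralCurveOn_Ioo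
    (contMDiff_section_of_contDiff hX)]
  intro a
  rcases le_or_gt a 0 with ha | ha
  · refine ⟨fun _ => x₀, rfl, fun t ht => ?_⟩
    exact absurd (ht.1.trans ht.2) (by linarith)
  lift a to ℝ≥0 using ha.le
  obtain ⟨K, hK⟩ := (hX.locallyLipschitz.locallyLipschitzOn
    (s := Metric.closedBall x₀ ((L * a : ℝ≥0) : ℝ))).exists_lipschitzOnWith_of_compact
    (isCompact_closedBall _ _)
  have hPL : IsPicardLindelof (fun _ => X)
      (⟨0, by constructor <;> linarith⟩ : Set.Icc (-(a : ℝ)) a) x₀ (L * a) 0 L K :=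
    { lipschitzOnWith := fun _ _ => hK
      continuousOn := fun _ _ => continuousOn_const
      norm_le := fun _ _ x _ => hL x
      mul_max_le := by simp }
  obtain ⟨γ, h0, hγ⟩ := hPL.exists_eq_forall_mem_Icc_hasDerivWithinAt₀
  refine ⟨γ, h0, fun t ht => ?_⟩
  have := (hγ t (Set.Ioo_subset_Icc_self ht)).hasDerivAt (Icc_mem_nhds ht.1 ht.2)
  exact (hasMFDerivAt_iff_hasFDerivAt.2 this.hasFDerivAt).hasMFDerivWithinAt

end GlobalODE

/-! ### Planar systems `α' = -w(β)`, `β' = u(α)` with increasing `u` and `w` -/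

section Planar

/-- The primitive of a strictly increasing function is strictly convex: it lies above its
tangents. -/
theorem tangent_lt_of_strictMono_deriv {A u : ℝ → ℝ} (hA : ∀ x, HasDerivAt A (u x) x)
    (hu : StrictMono u) {x y : ℝ} (hxy : x ≠ y) : A x + u x * (y - x) < A y := by
  have hc : Continuous A := continuous_iff_continuousAt.2 fun x => (hA x).continuousAt
  rcases hxy.lt_or_gt with h | h
  · obtain ⟨c, hc, e⟩ := exists_hasDerivAt_eq_slope A u h hc.continuousOn fun x _ => hA x
    rw [eq_div_iff (by linarith)] at e
    nlinarith [mul_pos (sub_pos.2 h) (sub_pos.2 (hu hc.1))]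
  · obtain ⟨c, hc, e⟩ := exists_hasDerivAt_eq_slope A u h hc.continuousOn fun x _ => hA x
    rw [eq_div_iff (by linarith)] at e
    nlinarith [mul_pos (sub_pos.2 h) (sub_pos.2 (hu hc.2))]

theorem bounded_sublevel_of_strictMono_deriv {A u : ℝ → ℝ} (hA : ∀ x, HasDerivAt A (u x) x)
    (hu : StrictMono u) {a : ℝ} (ha : u a = 0) (c : ℝ) :
    ∃ R, ∀ x, A x ≤ c → |x| ≤ R := by
  have h1 : 0 < u (a + 1) := ha ▸ hu (by linarith)
  have h2 : 0 < -u (a - 1) := by have := hu (show a - 1 < a by linarith); linarith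
  have tangent : ∀ x y, A x + u x * (y - x) ≤ A y := fun x y => by
    rcases eq_or_ne x y with rfl | h
    · simp
    · exact (tangent_lt_of_strictMono_deriv hA hu h).le
  -- the two tangents at `a + 1` and `a - 1` have slopes of opposite signs
  refine ⟨max (a + 1 + (c - A (a + 1)) / u (a + 1))
    (-(a - 1) + (c - A (a - 1)) / -u (a - 1)), fun x hx => abs_le'.2 ⟨?_, ?_⟩⟩
  · refine le_max_of_le_left ?_
    have : x - (a + 1) ≤ (c - A (a + 1)) / u (a + 1) := by
      rw [le_div_iff₀ h1]; linarith [tangent (a + 1) x]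
    linarith
  · refine le_max_of_le_right ?_
    have : (a - 1) - x ≤ (c - A (a - 1)) / -u (a - 1) := by
      rw [le_div_iff₀ h2]; linarith [tangent (a - 1) x]
    linarith

/-- A convex function is injective on either side of its minimum. -/
theorem eq_of_same_side_of_strictMono_deriv {A u : ℝ → ℝ} (hA : ∀ x, HasDerivAt A (u x) x)
    (hu : StrictMono u) {a : ℝ} (ha : u a = 0) {x y : ℝ} (hxy : A x = A y)
    (hside : (a ≤ x ∧ a ≤ y) ∨ (x ≤ a ∧ y ≤ a)) : x = y := by
  by_contra hne
  wlog h : x < y generalizing x y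
  · exact this hxy.symm (by tauto) (Ne.symm hne) (lt_of_le_of_ne (not_lt.1 h) (Ne.symm hne))
  rcases hside with ⟨h1, -⟩ | ⟨-, h2⟩
  · have := tangent_lt_of_strictMono_deriv hA hu hne
    have := hu.monotone h1
    nlinarith [mul_nonneg (ha ▸ this) (sub_pos.2 h).le]
  · have := tangent_lt_of_strictMono_deriv hA hu (Ne.symm hne)
    have := hu.monotone h2
    rw [ha] at this
    nlinarith [mul_nonneg (neg_nonneg.2 this) (sub_pos.2 h).le]

theorem not_bounded_of_le_deriv {h h' : ℝ → ℝ} (hd : ∀ t, HasDerivAt h (h' t) t) {R : ℝ}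
    (hR : ∀ t, |h t| ≤ R) {δ T : ℝ} (hδ : 0 < δ) (hT : ∀ t, T < t → δ ≤ h' t) : False := by
  have hR0 : 0 ≤ R := (abs_nonneg _).trans (hR 0)
  have key := (convex_Ici T).mul_sub_le_image_sub_of_le_deriv (f := h) (C := δ)
    (fun t _ => (hd t).continuousAt.continuousWithinAt)
    (fun t _ => (hd t).differentiableAt.differentiableWithinAt)
    (fun t ht => by rw [interior_Ici] at ht; rw [(hd t).deriv]; exact hT t ht)
    T Set.self_mem_Ici (T + (2 * R + 1) / δ)
    (by simp only [Set.mem_Ici, le_add_iff_nonneg_right]; positivity)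
    (by simp only [le_add_iff_nonneg_right]; positivity)
  rw [add_sub_cancel_left, mul_div_cancel₀ _ hδ.ne'] at key
  linarith [(abs_le.1 (hR (T + (2 * R + 1) / δ))).2, (abs_le.1 (hR T)).1]

variable {u w α β : ℝ → ℝ} {a b : ℝ}

/-- While `α > a`, the coordinate `β` increases. If it passes `b`, then `α` decreases at a positive
rate from then on; otherwise `α` increases, and so `β` grows at a positive rate. -/
theorem not_forall_gt_of_bounded (hu : StrictMono u) (hw : StrictMono w) (ha : u a = 0)
    (hb : w b = 0) (hα : ∀ t, HasDerivAt α (-w (β t)) t) (hβ : ∀ t, HasDerivAt β (u (α t)) t)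
    {R S : ℝ} (hR : ∀ t, |α t| ≤ R) (hS : ∀ t, |β t| ≤ S) {t₀ : ℝ} (h : ∀ t, t₀ < t → a < α t) :
    False := by
  have βmono : MonotoneOn β (Set.Ioi t₀) := by
    refine monotoneOn_of_deriv_nonneg (convex_Ioi t₀)
      (fun t _ => (hβ t).continuousAt.continuousWithinAt)
      (fun t _ => (hβ t).differentiableAt.differentiableWithinAt) fun t ht => ?_
    rw [interior_Ioi] at ht
    rw [(hβ t).deriv, ← ha]
    exact (hu (h t ht)).le
  by_cases hex : ∃ t₁, t₀ < t₁ ∧ b < β t₁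
  · obtain ⟨t₁, h01, hb1⟩ := hex
    refine not_bounded_of_le_deriv (fun t => (hα t).neg) (fun t => by simpa using hR t)
      (δ := w (β t₁)) (T := t₁) (hb ▸ hw hb1) fun t ht => ?_
    rw [neg_neg]
    exact hw.monotone (βmono h01 (h01.trans ht) ht.le)
  · push Not at hex
    have αmono : MonotoneOn α (Set.Ioi t₀) := by
      refine monotoneOn_of_deriv_nonneg (convex_Ioi t₀)
        (fun t _ => (hα t).continuousAt.continuousWithinAt)
        (fun t _ => (hα t).differentiableAt.differentiableWithinAt) fun t ht => ?_
      rw [interior_Ioi] at ht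
      rw [(hα t).deriv, ← neg_zero, ← hb]
      exact neg_le_neg (hw.monotone (hex t ht))
    have h1 : t₀ < t₀ + 1 := by linarith
    refine not_bounded_of_le_deriv hβ hS (δ := u (α (t₀ + 1))) (T := t₀ + 1)
      (ha ▸ hu (h _ h1)) fun t ht => hu.monotone (αmono h1 (h1.trans ht) ht.le)

theorem exists_gt_eq_of_bounded (hu : StrictMono u) (hw : StrictMono w) (ha : u a = 0)
    (hb : w b = 0) (hα : ∀ t, HasDerivAt α (-w (β t)) t) (hβ : ∀ t, HasDerivAt β (u (α t)) t)
    {R S : ℝ} (hR : ∀ t, |α t| ≤ R) (hS : ∀ t, |β t| ≤ S) (t₀ : ℝ) :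
    ∃ t, t₀ < t ∧ α t = a := by
  by_contra! hne
  have hc : ContinuousOn α (Set.Ioi t₀) := fun t _ => (hα t).continuousAt.continuousWithinAt
  by_cases hex : ∃ t₁, t₀ < t₁ ∧ a < α t₁
  · obtain ⟨t₁, h01, h1⟩ := hex
    refine not_forall_gt_of_bounded hu hw ha hb hα hβ hR hS (t₀ := t₀) fun t ht => ?_
    by_contra! hle
    obtain ⟨s, hs, e⟩ := isPreconnected_Ioi.intermediate_value ht h01 hc ⟨hle, h1.le⟩
    exact hne s hs e
  · push Not at hex
    -- the point reflection `(α, β) ↦ (-α, -β)` turns this into the case `α > a`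
    refine not_forall_gt_of_bounded (u := fun x => -u (-x)) (w := fun x => -w (-x))
      (α := fun t => -α t) (β := fun t => -β t) (a := -a) (b := -b) (t₀ := t₀)
      (fun x y h => neg_lt_neg (hu (neg_lt_neg h))) (fun x y h => neg_lt_neg (hw (neg_lt_neg h)))
      (by simp [ha]) (by simp [hb]) (fun t => by simpa using (hα t).fun_neg)
      (fun t => by simpa using (hβ t).fun_neg) (fun t => by simpa using hR t)
      (fun t => by simpa using hS t)
      fun t ht => neg_lt_neg (lt_of_le_of_ne (hex t ht) (hne t ht))

/-- The orbit lies on a level set of the convex function `A(α) + B(β)`, where `A' = u` and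
`B' = w`. It returns to the line `α = a` infinitely often, and that line meets the level set in at
most two points. -/
theorem not_injective_of_strictMono (hu : StrictMono u) (hw : StrictMono w) (huc : Continuous u)
    (hwc : Continuous w) (ha : u a = 0) (hb : w b = 0)
    (hα : ∀ t, HasDerivAt α (-w (β t)) t) (hβ : ∀ t, HasDerivAt β (u (α t)) t) :
    ¬ Function.Injective fun t => (α t, β t) := by
  intro hinj
  obtain ⟨A, hA⟩ : ∃ A : ℝ → ℝ, ∀ x, HasDerivAt A (u x) x :=
    ⟨fun x => ∫ s in a..x, u s, fun x => huc.integral_hasStrictDerivAt a x |>.hasDerivAt⟩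
  obtain ⟨B, hB⟩ : ∃ B : ℝ → ℝ, ∀ x, HasDerivAt B (w x) x :=
    ⟨fun x => ∫ s in b..x, w s, fun x => hwc.integral_hasStrictDerivAt b x |>.hasDerivAt⟩
  have hAmin : ∀ x, A a ≤ A x := fun x => by
    rcases eq_or_ne a x with rfl | h
    · exact le_rfl
    · simpa [ha] using (tangent_lt_of_strictMono_deriv hA hu h).le
  have hBmin : ∀ x, B b ≤ B x := fun x => by
    rcases eq_or_ne b x with rfl | h
    · exact le_rfl
    · simpa [hb] using (tangent_lt_of_strictMono_deriv hB hw h).le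
  have hd : ∀ t, HasDerivAt (fun t => A (α t) + B (β t)) 0 t := fun t =>
    (((hA (α t)).comp t (hα t)).add ((hB (β t)).comp t (hβ t))).congr_deriv (by ring)
  have hH : ∀ s t, A (α s) + B (β s) = A (α t) + B (β t) :=
    is_const_of_deriv_eq_zero (fun t => (hd t).differentiableAt) fun t => (hd t).deriv
  obtain ⟨R, hR⟩ := bounded_sublevel_of_strictMono_deriv hA hu ha (A (α 0) + B (β 0) - B b)
  obtain ⟨S, hS⟩ := bounded_sublevel_of_strictMono_deriv hB hw hb (A (α 0) + B (β 0) - A a)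
  have hret := exists_gt_eq_of_bounded hu hw ha hb hα hβ
    (fun t => hR _ (by linarith [hH t 0, hBmin (β t)]))
    (fun t => hS _ (by linarith [hH t 0, hAmin (α t)]))
  have hside : ∀ s t, s < t → α s = a → α t = a →
      ¬ ((b ≤ β s ∧ b ≤ β t) ∨ (β s ≤ b ∧ β t ≤ b)) := fun s t hst hs ht h => by
    have e : B (β s) = B (β t) := by have := hH s t; rw [hs, ht] at this; linarith
    exact hst.ne (hinj (Prod.ext (hs.trans ht.symm)
      (eq_of_same_side_of_strictMono_deriv hB hw hb e h)))
  obtain ⟨t₁, -, h1⟩ := hret 0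
  obtain ⟨t₂, h12, h2⟩ := hret t₁
  obtain ⟨t₃, h23, h3⟩ := hret t₂
  have := hside t₁ t₂ h12 h1 h2
  have := hside t₁ t₃ (h12.trans h23) h1 h3
  have := hside t₂ t₃ h23 h2 h3
  rcases le_total b (β t₁) with _ | _ <;> rcases le_total b (β t₂) with _ | _ <;>
    rcases le_total b (β t₃) with _ | _ <;> tauto

end Planar

/-! ### Gradient ascent -/

section GradientAscent

theorem contDiff_gradient {d : ℕ} {k : EuclideanSpace ℝ (Fin d) → ℝ} (hk : ContDiff ℝ 2 k) :
    ContDiff ℝ 1 (gradient k) :=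
  (InnerProductSpace.toDual ℝ (EuclideanSpace ℝ (Fin d))).symm.contDiff.comp
    (hk.fderiv_right (m := 1) (by norm_num))

variable {d : ℕ} {k : EuclideanSpace ℝ (Fin d) → ℝ} {x₀ : EuclideanSpace ℝ (Fin d)}
  {x : ℝ → EuclideanSpace ℝ (Fin d)}

theorem hasDerivAt_comp_gradientAscent (hk : Differentiable ℝ k)
    (hx : HiddenGame.IsGradientAscent k x₀ x) (s : ℝ) :
    HasDerivAt (fun s => k (x s)) (‖gradient k (x s)‖ ^ 2) s := by
  have h := (hk (x s)).hasGradientAt.hasFDerivAt.comp_hasDerivAt s (hx.2 s)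
  exact h.congr_deriv (by rw [InnerProductSpace.toDual_apply_apply, real_inner_self_eq_norm_sq])

/-- A trajectory through a critical point is constant, so that one starting off the critical set
never meets it. -/
theorem gradient_ne_zero_of_gradientAscent (hk : ContDiff ℝ 2 k)
    (hx : HiddenGame.IsGradientAscent k x₀ x) (h0 : gradient k x₀ ≠ 0) (s : ℝ) :
    gradient k (x s) ≠ 0 := by
  intro hs
  have := integralCurve_eq_of_contDiff (contDiff_gradient hk) hx.2
    (γ' := fun _ => x s) (fun t => by rw [hs]; exact hasDerivAt_const _ _) (t₀ := s) rfl
  rw [← hx.1, this] at h0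
  exact h0 hs

theorem strictMono_comp_gradientAscent (hk : ContDiff ℝ 2 k)
    (hx : HiddenGame.IsGradientAscent k x₀ x) (h0 : gradient k x₀ ≠ 0) :
    StrictMono fun s => k (x s) :=
  strictMono_of_hasDerivAt_pos
    (hasDerivAt_comp_gradientAscent (hk.differentiable two_ne_zero) hx) fun s =>
      pow_pos (norm_pos_iff.2 (gradient_ne_zero_of_gradientAscent hk hx h0 s)) 2

theorem contDiff_comp_gradientAscent (hk : ContDiff ℝ 2 k)
    (hx : HiddenGame.IsGradientAscent k x₀ x) : ContDiff ℝ 1 fun s => k (x s) := by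
  refine (hk.of_le one_le_two).comp (contDiff_one_iff_deriv.2
    ⟨fun s => (hx.2 s).differentiableAt, ?_⟩)
  rw [show deriv x = fun s => gradient k (x s) from funext fun s => (hx.2 s).deriv]
  exact (contDiff_gradient hk).continuous.comp
    (continuous_iff_continuousAt.2 fun s => (hx.2 s).continuousAt)

end GradientAscent

/-! ### Components of a curve in a product -/

section Prod

variable {E F : Type*} [NormedAddCommGroup E] [NormedSpace ℝ E] [NormedAddCommGroup F]
  [NormedSpace ℝ F] {γ : ℝ → E × F} {γ' : E × F} {t : ℝ}

theorem hasDerivAt_fst_of_prod (h : HasDerivAt γ γ' t) : HasDerivAt (fun s => (γ s).1) γ'.1 t :=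
  (hasFDerivAt_fst (𝕜 := ℝ) (p := γ t)).comp_hasDerivAt t h

theorem hasDerivAt_snd_of_prod (h : HasDerivAt γ γ' t) : HasDerivAt (fun s => (γ s).2) γ'.2 t :=
  (hasFDerivAt_snd (𝕜 := ℝ) (p := γ t)).comp_hasDerivAt t h

end Prod

/-! ### Orbits of the hidden game -/

theorem mainTheorem1 {n m : ℕ}
    (f : EuclideanSpace ℝ (Fin n) → ℝ) (g : EuclideanSpace ℝ (Fin m) → ℝ)
    (hf : ContDiff ℝ 2 f) (hg : ContDiff ℝ 2 g)
    (hf01 : ∀ θ, f θ ∈ Set.Icc (0 : ℝ) 1) (hg01 : ∀ φ, g φ ∈ Set.Icc (0 : ℝ) 1)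
    (U : Matrix (Fin 2) (Fin 2) ℝ) (p q : ℝ) (hN : HiddenGame.IsUniqueMixedNash U p q)
    (θ₀ : EuclideanSpace ℝ (Fin n)) (φ₀ : EuclideanSpace ℝ (Fin m))
    (hsafe : HiddenGame.IsSafe f g p q θ₀ φ₀) :
    (∃! z : ℝ → EuclideanSpace ℝ (Fin n) × EuclideanSpace ℝ (Fin m),
      HiddenGame.IsGDAOrbit U f g θ₀ φ₀ z) ∧
    ∀ z : ℝ → EuclideanSpace ℝ (Fin n) × EuclideanSpace ℝ (Fin m),
      HiddenGame.IsGDAOrbit U f g θ₀ φ₀ z → ∃ T : ℝ, 0 < T ∧ Function.Periodic z T := by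
  have hfd := hf.differentiable two_ne_zero
  have hgd := hg.differentiable two_ne_zero
  obtain ⟨x, hx, a, ha⟩ := hsafe.p_mem
  obtain ⟨y, hy, b, hb⟩ := hsafe.q_mem
  have hv : HiddenGame.gameCoeff U ≠ 0 := ((HiddenGame.isUniqueMixedNash_iff U p q).1 hN).1
  set v := HiddenGame.gameCoeff U with hv_def
  -- the field of the full system is `C¹`, so that orbits are determined by their initial value
  set Y : EuclideanSpace ℝ (Fin n) × EuclideanSpace ℝ (Fin m) →
      EuclideanSpace ℝ (Fin n) × EuclideanSpace ℝ (Fin m) := fun z =>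
    (-(v * (g z.2 - q)) • gradient f z.1, (v * (f z.1 - p)) • gradient g z.2) with hY_def
  have hY : ContDiff ℝ 1 Y := by
    have h1 : ContDiff ℝ 1 f := hf.of_le one_le_two
    have h2 : ContDiff ℝ 1 g := hg.of_le one_le_two
    have h3 := contDiff_gradient hf
    have h4 := contDiff_gradient hg
    fun_prop
  have orbit_iff : ∀ z, HiddenGame.IsGDAOrbit U f g θ₀ φ₀ z ↔
      z 0 = (θ₀, φ₀) ∧ ∀ t, HasDerivAt z (Y (z t)) t := fun z => by
    rw [HiddenGame.isGDAOrbit_iff hfd hgd hN]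
    refine and_congr_right fun _ => forall_congr' fun t => ?_
    exact ⟨fun h => h.1.prodMk h.2, fun h => ⟨hasDerivAt_fst_of_prod h, hasDerivAt_snd_of_prod h⟩⟩
  -- the reduced system for the parameters along the two gradient trajectories
  set u : ℝ → ℝ := fun s => f (x s) - p with hu_def
  set w : ℝ → ℝ := fun s => g (y s) - q with hw_def
  have huC : ContDiff ℝ 1 u := (contDiff_comp_gradientAscent hf hx).sub contDiff_const
  have hwC : ContDiff ℝ 1 w := (contDiff_comp_gradientAscent hg hy).sub contDiff_const
  have hu : StrictMono u := fun s t h => sub_lt_sub_right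
    (strictMono_comp_gradientAscent hf hx hsafe.grad_f_ne h) p
  have hw : StrictMono w := fun s t h => sub_lt_sub_right
    (strictMono_comp_gradientAscent hg hy hsafe.grad_g_ne h) q
  have hu1 : ∀ s, ‖u s‖ ≤ 1 := fun s => by
    have h1 := hf01 (x s)
    have h2 := hf01 (x a)
    rw [ha] at h2
    exact abs_le.2 ⟨by linarith [h1.1, h2.2], by linarith [h1.2, h2.1]⟩
  have hw1 : ∀ s, ‖w s‖ ≤ 1 := fun s => by
    have h1 := hg01 (y s)
    have h2 := hg01 (y b)
    rw [hb] at h2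
    exact abs_le.2 ⟨by linarith [h1.1, h2.2], by linarith [h1.2, h2.1]⟩
  obtain ⟨γ, hγ0, hγ⟩ := exists_integralCurve_of_bounded (L := 1)
    (X := fun c : ℝ × ℝ => (-w c.2, u c.1)) (by fun_prop)
    (fun c => by simpa [Prod.norm_def] using ⟨hw1 c.2, hu1 c.1⟩) (0, 0)
  have hα : ∀ t, HasDerivAt (fun s => (γ s).1) (-w (γ t).2) t := fun t =>
    hasDerivAt_fst_of_prod (hγ t)
  have hβ : ∀ t, HasDerivAt (fun s => (γ s).2) (u (γ t).1) t := fun t =>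
    hasDerivAt_snd_of_prod (hγ t)
  have hninj : ¬ Function.Injective γ := not_injective_of_strictMono hu hw huC.continuous
    hwC.continuous (sub_eq_zero.2 ha) (sub_eq_zero.2 hb) hα hβ
  -- both equations of the full system carry the factor `v`, which is absorbed by rescaling time
  set z : ℝ → EuclideanSpace ℝ (Fin n) × EuclideanSpace ℝ (Fin m) := fun t =>
    (x (γ (t * v)).1, y (γ (t * v)).2) with hz_def
  have hz : HiddenGame.IsGDAOrbit U f g θ₀ φ₀ z := by
    refine (orbit_iff z).2 ⟨by simp [hz_def, hγ0, hx.1, hy.1], fun t => ?_⟩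
    have htv : HasDerivAt (fun s : ℝ => s * v) v t := by
      simpa using (hasDerivAt_id t).mul_const v
    have e1 := (hx.2 _).scomp t ((hα (t * v)).comp t htv)
    have e2 := (hy.2 _).scomp t ((hβ (t * v)).comp t htv)
    refine (e1.prodMk e2).congr_deriv (Prod.ext (congrArg (· • gradient f _) ?_)
      (congrArg (· • gradient g _) ?_))
    · rw [neg_mul, mul_comm]
    · rw [mul_comm]
  have unique : ∀ z', HiddenGame.IsGDAOrbit U f g θ₀ φ₀ z' → z' = z := fun z' hz' => by
    rw [orbit_iff] at hz hz'
    exact integralCurve_eq_of_contDiff hY hz'.2 hz.2 (hz'.1.trans hz.1.symm)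
  refine ⟨⟨z, hz, unique⟩, fun z' hz' => ?_⟩
  rw [unique z' hz']
  refine exists_periodic_of_not_injective hY ((orbit_iff z).1 hz).2 fun hinj => hninj ?_
  intro s t hst
  have : s / v = t / v := hinj (by simp only [hz_def, div_mul_cancel₀ _ hv, hst])
  exact (div_left_inj' hv).1 this
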